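/- For $n\in\{0,1,2,\ldots\}$ let $H_n=\sum_{0<k\le n}\frac1k$ denote the $n$-th harmonic number (so $H_0=0$). Then the following three series converge (absolutely), with the values $$\sum_{k=1}^\infty\frac{\binom{4k}{k}\left((11k^2+8k+1)H_k+6k+6+\frac{4}{3k}\right)}{(3k+1)(3k+2)16^k}=\frac{4}{3}\log 2,$$ $$\sum_{k=0}^\infty\frac{\binom{4k}{k}\left((11k^2+8k+1)\left(H_{2k}-\frac{5}{4}H_k\right)+4k+1\right)}{(3k+1)(3k+2)16^k}=\log 2,$$ $$\sum_{k=0}^\infty\frac{\binom{4k}{k}\left((11k^2+8k+1)\left(10H_{4k}-17H_{2k}\right)+2k+18\right)}{(3k+1)(3k+2)16^k}=8\log 2.$$ -/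

import Mathlib

open Finset

/-! Up to a constant factor, `ballot n j` is n Γ(n+j+1/2) Γ(n+j) / (j! (2n+j)!). With companion
-2j/n times itself it satisfies a WZ relation linking row n+1 at j to row n at j+1. Shifting
n+j+1/2, n+j, j+1 by multiples u, v, w of a small parameter, with corrections in n alone, and
differentiating at 0 multiplies each entry by a combination of harmonic numbers and keeps the
relation (`ballot_wz`).

Summing it over a row telescopes (`ballotSum_succ_sub`): the increment of `ballotSum` is a multiple
of the diagonal entry, where C(4n,n)/16^n appears, plus w times an elementary term. Row sums decay
geometrically (`summable_ballotSum`), so summing over n leaves the first row sum and a logarithmic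
series (`hasSum_ballot_diagonal`). Three choices of (u, v, w) give the three identities. -/

/-- The normalized ballot number `n / (n + j) * (2n + 2j choose j) / 4 ^ (n + j)`. -/
noncomputable def ballot (n j : ℕ) : ℝ :=
  n * (2 * (n + j)).factorial /
    ((n + j) * 4 ^ (n + j) * j.factorial * (2 * n + j).factorial)

/-- The real-valued harmonic number. -/
noncomputable def harm (n : ℕ) : ℝ := (harmonic n : ℝ)

/-- The logarithmic derivative of the parametrized ballot numbers in the direction `(u, v, w)`. -/
noncomputable def ballotLog (u v w : ℝ) (n j : ℕ) : ℝ :=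
  u * (2 * harm (2 * (n + j)) - harm (n + j) - 4 * harm (2 * n) + 2 * harm n) +
  v * (harm (n + j) - 1 / (n + j) - 2 * harm n + 1 / n) +
  w * (2 * harm (2 * n) - 1 / n - harm j)

/-- The derivative of the Wilf–Zeilberger companion of the ballot numbers. -/
noncomputable def ballotMate (u v w : ℝ) (n j : ℕ) : ℝ :=
  -2 * ballot n j / n *
    (j * (ballotLog u v w n j - w / (2 * n + 1) - 2 * (u - w) / (2 * n + 1) - (v - w) / n) + w)

/-- The finite sums whose increments produce the diagonal terms. -/
noncomputable def ballotSum (u v w : ℝ) (n : ℕ) : ℝ :=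
  ∑ j ∈ range n, ballot n j * ballotLog u v w n j

/-! ### Harmonic numbers -/

lemma harm_zero : harm 0 = 0 := by simp [harm]

lemma harm_succ (n : ℕ) : harm (n + 1) = harm n + 1 / (n + 1) := by
  simp [harm, harmonic_succ]

lemma harm_two_mul_succ (n : ℕ) :
    harm (2 * (n + 1)) = harm (2 * n) + 1 / (2 * n + 1) + 1 / (2 * (n + 1)) := by
  rw [show 2 * (n + 1) = 2 * n + 1 + 1 by ring, harm_succ, harm_succ]
  push_cast
  ring

lemma harm_nonneg (n : ℕ) : 0 ≤ harm n := by
  induction n with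
  | zero => simp [harm_zero]
  | succ n ih => rw [harm_succ]; positivity

lemma harm_le (n : ℕ) : harm n ≤ n := by
  induction n with
  | zero => simp [harm_zero]
  | succ n ih =>
    rw [harm_succ]
    push_cast
    have : (1 : ℝ) / (n + 1) ≤ 1 := by
      rw [div_le_one (by positivity)]
      have : (0 : ℝ) ≤ n := n.cast_nonneg
      linarith
    linarith

/-! ### Ballot numbers and their WZ relation -/

lemma ballot_eq (n j : ℕ) :
    ballot n j = n / (n + j) * ((2 * (n + j)).choose j / 4 ^ (n + j)) := by
  have h : ((2 * (n + j)).choose j : ℝ) =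
      (2 * (n + j)).factorial / (j.factorial * (2 * n + j).factorial) := by
    rw [Nat.cast_choose ℝ (by omega), show 2 * (n + j) - j = 2 * n + j by omega]
  rw [h, ballot]
  field_simp

lemma ballot_nonneg (n j : ℕ) : 0 ≤ ballot n j := by
  unfold ballot
  positivity

lemma ballot_zero_right {n : ℕ} (hn : n ≠ 0) : ballot n 0 = 1 / 4 ^ n := by
  have : (n : ℝ) ≠ 0 := by exact_mod_cast hn
  rw [ballot_eq]
  simp [this]

lemma ballot_one_right {n : ℕ} (hn : n ≠ 0) : ballot n 1 = n / 2 / 4 ^ n := by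
  have : (n : ℝ) ≠ 0 := by exact_mod_cast hn
  rw [ballot_eq]
  simp only [Nat.choose_one_right]
  push_cast
  rw [pow_succ]
  field_simp
  norm_num

lemma ballot_succ_left {n : ℕ} (hn : n ≠ 0) (j : ℕ) :
    ballot (n + 1) j = ballot n (j + 1) * ((n + 1) * (j + 1) / (n * (2 * n + j + 2))) := by
  have : (n : ℝ) ≠ 0 := by exact_mod_cast hn
  unfold ballot
  rw [show n + 1 + j = n + (j + 1) by ring,
    show 2 * (n + 1) + j = 2 * n + (j + 1) + 1 by ring, Nat.factorial_succ (2 * n + (j + 1)),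
    Nat.factorial_succ j]
  push_cast
  have h1 : (n : ℝ) + 1 + j ≠ 0 := by positivity
  have h2 : (n : ℝ) + (j + 1) ≠ 0 := by positivity
  field_simp
  ring

lemma ballot_succ_right {n : ℕ} (hn : n ≠ 0) (j : ℕ) :
    ballot n (j + 1) =
      ballot n j * ((n + j) * (2 * (n + j) + 1) / (2 * (j + 1) * (2 * n + j + 1))) := by
  have : (n : ℝ) ≠ 0 := by exact_mod_cast hn
  unfold ballot
  rw [show 2 * (n + (j + 1)) = 2 * (n + j) + 1 + 1 by ring, ← add_assoc n j 1,
    ← add_assoc (2 * n) j 1, Nat.factorial_succ (2 * (n + j) + 1),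
    Nat.factorial_succ (2 * (n + j)), Nat.factorial_succ (2 * n + j),
    Nat.factorial_succ j, pow_succ]
  push_cast
  have h1 : (n : ℝ) + j ≠ 0 := by positivity
  have h2 : (n : ℝ) + (j + 1) ≠ 0 := by positivity
  field_simp
  ring

lemma ballotLog_succ_left (u v w : ℝ) {n : ℕ} (hn : n ≠ 0) (j : ℕ) :
    ballotLog u v w (n + 1) j = ballotLog u v w n (j + 1) +
      (u * (-4 / (2 * n + 1)) + v * (-1 / n - 1 / (n + 1)) +
       w * (2 / (2 * n + 1) + 1 / n + 1 / (j + 1))) := by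
  have : (n : ℝ) ≠ 0 := by exact_mod_cast hn
  unfold ballotLog
  rw [show n + 1 + j = n + (j + 1) by ring, harm_two_mul_succ n, harm_succ n, harm_succ j]
  push_cast
  have e : (n : ℝ) + 1 + j = n + (j + 1) := by ring
  rw [e]
  field_simp
  ring

lemma ballotLog_succ_right (u v w : ℝ) {n : ℕ} (hn : n ≠ 0) (j : ℕ) :
    ballotLog u v w n (j + 1) = ballotLog u v w n j +
      (u * (2 / (2 * (n + j) + 1)) + v * (1 / (n + j)) - w * (1 / (j + 1))) := by
  have : (n : ℝ) ≠ 0 := by exact_mod_cast hn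
  unfold ballotLog
  rw [← add_assoc n j 1, harm_two_mul_succ (n + j), harm_succ (n + j), harm_succ j]
  push_cast
  have h1 : (n : ℝ) + j ≠ 0 := by positivity
  have h2 : (n : ℝ) + (j + 1) ≠ 0 := by positivity
  field_simp
  ring

lemma ballot_wz (u v w : ℝ) {n : ℕ} (hn : n ≠ 0) (j : ℕ) :
    ballot (n + 1) j * ballotLog u v w (n + 1) j -
        ballot n (j + 1) * ballotLog u v w n (j + 1) =
      ballotMate u v w n (j + 2) - ballotMate u v w n (j + 1) := by
  have : (n : ℝ) ≠ 0 := by exact_mod_cast hn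
  unfold ballotMate
  rw [show j + 2 = j + 1 + 1 by ring, ballot_succ_left hn, ballot_succ_right hn (j + 1),
    ballotLog_succ_left u v w hn, ballotLog_succ_right u v w hn (j + 1)]
  generalize ballotLog u v w n (j + 1) = l
  generalize ballot n (j + 1) = b
  push_cast
  have h1 : (n : ℝ) + (j + 1) ≠ 0 := by positivity
  have h2 : (2 : ℝ) * (n + (j + 1)) + 1 ≠ 0 := by positivity
  have h3 : (j : ℝ) + 1 + 1 ≠ 0 := by positivity
  have h4 : (2 : ℝ) * n + (j + 1) + 1 ≠ 0 := by positivity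
  have h5 : (2 : ℝ) * n + j + 2 ≠ 0 := by positivity
  field_simp
  ring

/-- The lower boundary of the telescoped row: the logarithmic derivative cancels and only w
survives. This is the sole source of log 2. -/
lemma ballotMate_one (u v w : ℝ) {n : ℕ} (hn : n ≠ 0) :
    ballotMate u v w n 1 + ballot n 0 * ballotLog u v w n 0 =
      -w * ((1 / 4) ^ n * (1 / n + 1 / (2 * n + 1))) := by
  have : (n : ℝ) ≠ 0 := by exact_mod_cast hn
  unfold ballotMate
  have hl := ballotLog_succ_right u v w hn 0
  rw [zero_add] at hl
  rw [hl, ballot_one_right hn, ballot_zero_right hn, one_div_pow]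
  generalize ballotLog u v w n 0 = l
  push_cast
  field_simp
  ring

/-- The upper boundary, with n = k + 1: two entries of row n + 1 have no partner in row n. Every
term is a rational multiple of the diagonal entry, which produces 11n² + 8n + 1. -/
lemma ballot_edge (u v w : ℝ) (k : ℕ) {n : ℝ} (hk : n = k + 1) :
    ballot (k + 2) k * ballotLog u v w (k + 2) k +
        ballot (k + 2) (k + 1) * ballotLog u v w (k + 2) (k + 1) +
        ballotMate u v w (k + 1) (k + 1) =
      -(ballot (k + 1) (k + 1) *
        ((11 * n ^ 2 + 8 * n + 1) * ballotLog u v w (k + 1) (k + 1) +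
          (u * (2 - 6 * n) - v * (12 * n ^ 2 + 15 * n + 3) / (2 * n) +
            w * (28 * n ^ 2 + 19 * n + 3) / n)) / ((3 * n + 1) * (3 * n + 2))) := by
  have hk1 : k + 1 ≠ 0 := k.succ_ne_zero
  have hn : 0 < n := by rw [hk]; positivity
  unfold ballotMate
  rw [show k + 2 = k + 1 + 1 by ring, ballot_succ_left hk1, ballot_succ_left hk1,
    ballot_succ_right hk1 (k + 1), ballotLog_succ_left u v w hk1,
    ballotLog_succ_left u v w hk1, ballotLog_succ_right u v w hk1 (k + 1)]
  generalize ballotLog u v w (k + 1) (k + 1) = l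
  generalize ballot (k + 1) (k + 1) = b
  push_cast
  rw [← hk, show (k : ℝ) = n - 1 by rw [hk]; ring]
  have e2 : (2 * n + (n - 1) + 2 : ℝ) = 3 * n + 1 := by ring
  have e3 : (2 * n + n + 1 : ℝ) = 3 * n + 1 := by ring
  have e4 : (2 * n + n + 2 : ℝ) = 3 * n + 2 := by ring
  have e5 : (n + n : ℝ) = 2 * n := by ring
  rw [e2, e3, e4, e5]
  field_simp
  ring

lemma ballotSum_succ_sub (u v w : ℝ) {n : ℕ} (hn : n ≠ 0) :
    ballotSum u v w (n + 1) - ballotSum u v w n =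
      -(ballot n n *
        ((11 * n ^ 2 + 8 * n + 1) * ballotLog u v w n n +
          (u * (2 - 6 * n) - v * (12 * n ^ 2 + 15 * n + 3) / (2 * n) +
            w * (28 * n ^ 2 + 19 * n + 3) / n)) / ((3 * n + 1) * (3 * n + 2))) +
        w * ((1 / 4) ^ n * (1 / n + 1 / (2 * n + 1))) := by
  obtain ⟨k, rfl⟩ := Nat.exists_eq_succ_of_ne_zero hn
  have hsum : ∑ j ∈ range k, (ballot (k + 2) j * ballotLog u v w (k + 2) j -
        ballot (k + 1) (j + 1) * ballotLog u v w (k + 1) (j + 1)) =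
      ballotMate u v w (k + 1) (k + 1) - ballotMate u v w (k + 1) 1 := by
    rw [← Finset.sum_range_sub (fun j => ballotMate u v w (k + 1) (j + 1)) k]
    exact Finset.sum_congr rfl fun j _ => ballot_wz u v w hn j
  have h1 := ballotMate_one u v w hn
  have h2 := ballot_edge u v w k (n := ((k + 1 : ℕ) : ℝ)) (by push_cast; ring)
  rw [Finset.sum_sub_distrib] at hsum
  unfold ballotSum
  simp only [Nat.succ_eq_add_one] at *
  -- Split off the last two entries of row k + 2 and the entry j = 0 of row k + 1; the rest pair up
  -- as in `hsum`.
  rw [Finset.sum_range_succ, Finset.sum_range_succ _ k, Finset.sum_range_succ' _ k]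
  linarith

/-! ### Decay of the row sums -/

lemma ballot_le {n j : ℕ} (hj : j ≤ n) : ballot n j ≤ (81 / 128) ^ n := by
  have hle : (n : ℝ) / (n + j) ≤ 1 := div_le_one_of_le₀ (by simp) (by positivity)
  -- One term of the binomial expansion of (1/2 + 1)^(2(n+j)). Weight 1 would only bound the
  -- binomial by 4^(n+j), giving no decay; weight 1/2 gives the ratio 9/16 · 9/8 = 81/128 when j ≤
  -- n.
  have hterm : ((2 * (n + j)).choose j : ℝ) * (1 / 2) ^ j ≤ (3 / 2) ^ (2 * (n + j)) := by
    have h := add_pow (1 / 2 : ℝ) 1 (2 * (n + j))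
    rw [show (1 / 2 + 1 : ℝ) = 3 / 2 by norm_num] at h
    rw [h]
    refine le_trans (le_of_eq ?_) (Finset.single_le_sum (a := j) (fun i _ => by positivity)
      (Finset.mem_range.2 (by omega)))
    simp [mul_comm]
  have hchoose : ((2 * (n + j)).choose j : ℝ) / 4 ^ (n + j) ≤ (9 / 16) ^ (n + j) * 2 ^ j := by
    rw [div_le_iff₀ (by positivity)]
    have h2 : (1 / 2 : ℝ) ^ j * 2 ^ j = 1 := by rw [← mul_pow]; norm_num
    calc ((2 * (n + j)).choose j : ℝ)
        = ((2 * (n + j)).choose j : ℝ) * (1 / 2) ^ j * 2 ^ j := by rw [mul_assoc, h2, mul_one]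
      _ ≤ (3 / 2) ^ (2 * (n + j)) * 2 ^ j := by gcongr
      _ = (9 / 16) ^ (n + j) * 2 ^ j * 4 ^ (n + j) := by
        rw [pow_mul, mul_right_comm, ← mul_pow]; norm_num
  calc ballot n j = n / (n + j) * ((2 * (n + j)).choose j / 4 ^ (n + j)) := ballot_eq n j
    _ ≤ 1 * ((9 / 16) ^ (n + j) * 2 ^ j) := by gcongr
    _ = (9 / 16) ^ n * (9 / 8) ^ j := by rw [one_mul, pow_add, mul_assoc, ← mul_pow]; norm_num
    _ ≤ (9 / 16) ^ n * (9 / 8) ^ n := by gcongr; norm_num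
    _ = (81 / 128) ^ n := by rw [← mul_pow]; norm_num

lemma abs_ballotLog_le (u v w : ℝ) {n j : ℕ} (hn : n ≠ 0) (hj : j ≤ n) :
    |ballotLog u v w n j| ≤ 20 * (|u| + |v| + |w|) * n := by
  have hn1 : (1 : ℝ) ≤ n := by exact_mod_cast Nat.one_le_iff_ne_zero.2 hn
  have hjn : (j : ℝ) ≤ n := by exact_mod_cast hj
  have hinv : (1 : ℝ) / n ≤ 1 := by rw [div_le_one (by linarith)]; exact hn1
  have hinv0 : (0 : ℝ) ≤ 1 / n := by positivity
  have hinv' : (1 : ℝ) / (n + j) ≤ 1 := by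
    rw [div_le_one (by positivity)]
    linarith [j.cast_nonneg (α := ℝ)]
  have hinv0' : (0 : ℝ) ≤ 1 / (n + j) := by positivity
  have a1 := harm_le (2 * (n + j))
  have a2 := harm_le (n + j)
  have a3 := harm_le (2 * n)
  have a4 := harm_le n
  have a5 := harm_le j
  have b1 := harm_nonneg (2 * (n + j))
  have b2 := harm_nonneg (n + j)
  have b3 := harm_nonneg (2 * n)
  have b4 := harm_nonneg n
  have b5 := harm_nonneg j
  push_cast at a1 a2 a3
  unfold ballotLog
  have hu : |2 * harm (2 * (n + j)) - harm (n + j) - 4 * harm (2 * n) + 2 * harm n| ≤ 20 * n := by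
    rw [abs_le]; constructor <;> linarith
  have hv : |harm (n + j) - 1 / (n + j) - 2 * harm n + 1 / n| ≤ 20 * n := by
    rw [abs_le]; constructor <;> linarith
  have hw : |2 * harm (2 * n) - 1 / n - harm j| ≤ 20 * n := by
    rw [abs_le]; constructor <;> linarith
  calc _ ≤ |u| * (20 * n) + |v| * (20 * n) + |w| * (20 * n) := by
        refine (abs_add_three _ _ _).trans ?_
        rw [abs_mul, abs_mul, abs_mul]
        gcongr
    _ = _ := by ring

lemma summable_ballotSum (u v w : ℝ) : Summable (ballotSum u v w) := by
  have h : ‖(81 / 128 : ℝ)‖ < 1 := by norm_num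
  have hg : Summable fun n : ℕ => 20 * (|u| + |v| + |w|) * ((n : ℝ) ^ 2 * (81 / 128 : ℝ) ^ n) :=
    Summable.mul_left _ (summable_pow_mul_geometric_of_norm_lt_one (R := ℝ) (r := 81 / 128) 2 h)
  refine Summable.of_norm_bounded hg fun n => ?_
  rcases eq_or_ne n 0 with rfl | hn
  · simp [ballotSum]
  unfold ballotSum
  calc ‖∑ j ∈ range n, ballot n j * ballotLog u v w n j‖
      ≤ ∑ j ∈ range n, (81 / 128) ^ n * (20 * (|u| + |v| + |w|) * n) := by
        refine norm_sum_le_of_le _ fun j hj => ?_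
        have hj' : j ≤ n := (Finset.mem_range.1 hj).le
        rw [norm_mul, Real.norm_eq_abs, Real.norm_eq_abs, abs_of_nonneg (ballot_nonneg n j)]
        exact mul_le_mul (ballot_le hj') (abs_ballotLog_le u v w hn hj') (abs_nonneg _)
          (by positivity)
    _ = _ := by
        rw [Finset.sum_const, Finset.card_range, nsmul_eq_mul]
        ring

/-! ### Evaluation of the series -/

lemma hasSum_quarter_pow_mul :
    HasSum (fun k : ℕ => (1 / 4 : ℝ) ^ (k + 1) *
      (1 / ((k + 1 : ℕ) : ℝ) + 1 / (2 * ((k + 1 : ℕ) : ℝ) + 1))) (2 * Real.log 2 - 1) := by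
  -- The two parts sum to log(4/3) and log 3 - 1, the -1 coming from the dropped zeroth term of the
  -- second series.
  have h1 := Real.hasSum_pow_div_log_of_abs_lt_one (x := 1 / 4) (by norm_num [abs_lt])
  have h2 := Real.hasSum_log_sub_log_of_abs_lt_one (x := 1 / 2) (by norm_num [abs_lt])
  rw [← hasSum_nat_add_iff' 1] at h2
  convert h1.add h2 using 1
  · funext k
    rw [pow_succ _ (2 * (k + 1)), pow_mul]
    push_cast
    rw [show ((1 / 2 : ℝ) ^ 2) = 1 / 4 by norm_num]
    ring
  · rw [show (1 - 1 / 4 : ℝ) = 3 / 2 ^ 2 by norm_num, show (1 + 1 / 2 : ℝ) = 3 / 2 by norm_num,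
      show (1 - 1 / 2 : ℝ) = 1 / 2 by norm_num, Real.log_div (by norm_num) (by norm_num),
      Real.log_div (by norm_num) (by norm_num), Real.log_div (by norm_num) (by norm_num),
      Real.log_pow]
    norm_num

lemma hasSum_of_eq {f g : ℕ → ℝ} {a b : ℝ} (h : HasSum f a) (hfg : ∀ k, g k = f k) (hab : b = a) :
    HasSum g b := by
  rw [hab, funext hfg]
  exact h

lemma hasSum_ballot_diagonal (u v w : ℝ) :
    HasSum (fun k : ℕ => 2 * (ballot (k + 1) (k + 1) *
        ((11 * ((k + 1 : ℕ) : ℝ) ^ 2 + 8 * ((k + 1 : ℕ) : ℝ) + 1) *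
            ballotLog u v w (k + 1) (k + 1) +
          (u * (2 - 6 * ((k + 1 : ℕ) : ℝ)) -
            v * (12 * ((k + 1 : ℕ) : ℝ) ^ 2 + 15 * ((k + 1 : ℕ) : ℝ) + 3) /
              (2 * ((k + 1 : ℕ) : ℝ)) +
            w * (28 * ((k + 1 : ℕ) : ℝ) ^ 2 + 19 * ((k + 1 : ℕ) : ℝ) + 3) /
              ((k + 1 : ℕ) : ℝ))) /
        ((3 * ((k + 1 : ℕ) : ℝ) + 1) * (3 * ((k + 1 : ℕ) : ℝ) + 2))))
      (4 * w * Real.log 2 - u - v / 2 - w) := by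
  have hs := (summable_ballotSum u v w).hasSum
  have h1 := (hasSum_nat_add_iff' 1).2 hs
  have h2 := (hasSum_nat_add_iff' 2).2 hs
  have h := ((h1.sub h2).add (hasSum_quarter_pow_mul.mul_left w)).mul_left 2
  refine hasSum_of_eq h (fun k => ?_) ?_
  · have := ballotSum_succ_sub u v w k.succ_ne_zero
    simp only [Nat.succ_eq_add_one] at this
    rw [show k + 2 = k + 1 + 1 from rfl]
    linarith
  · have hb : ballotSum u v w 1 = 1 / 4 * (-2 * u - v + 2 * w) := by
      have e1 : harm 1 = 1 := by simpa [harm_zero] using harm_succ 0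
      have e2 : harm 2 = 3 / 2 := by
        have := harm_succ 1
        rw [e1] at this
        norm_num at this
        exact this
      simp [ballotSum, ballot_zero_right, ballotLog, e1, e2, harm_zero]
      ring
    rw [Finset.sum_range_succ _ 1, hb, Finset.sum_range_one]
    ring

lemma ballot_diag (k : ℕ) :
    ballot (k + 1) (k + 1) = (Nat.choose (4 * (k + 1)) (k + 1) : ℝ) / (2 * 16 ^ (k + 1)) := by
  rw [ballot_eq, show 2 * (k + 1 + (k + 1)) = 4 * (k + 1) by ring, ← two_mul (k + 1), pow_mul]
  push_cast
  field_simp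
  norm_num [mul_comm]

lemma ballotLog_diag (u v w : ℝ) (k : ℕ) :
    ballotLog u v w (k + 1) (k + 1) =
      2 * u * harm (4 * (k + 1)) + (-5 * u + v + 2 * w) * harm (2 * (k + 1)) +
        (2 * u - 2 * v - w) * harm (k + 1) + (v / 2 - w) / ((k + 1 : ℕ) : ℝ) := by
  unfold ballotLog
  rw [show 2 * (k + 1 + (k + 1)) = 4 * (k + 1) by ring, ← two_mul (k + 1)]
  push_cast
  field_simp
  ring

theorem theorem2 :
    HasSum (fun k : Set.Ici (1 : ℕ) =>
        ((Nat.choose (4 * k) k : ℝ) *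
            ((11 * (k : ℝ) ^ 2 + 8 * (k : ℝ) + 1) * (harmonic k : ℝ)
              + 6 * (k : ℝ) + 6 + 4 / (3 * (k : ℝ))))
          / ((3 * (k : ℝ) + 1) * (3 * (k : ℝ) + 2) * 16 ^ (k : ℕ)))
      (4 / 3 * Real.log 2) ∧
    HasSum (fun k : ℕ =>
        ((Nat.choose (4 * k) k : ℝ) *
            ((11 * (k : ℝ) ^ 2 + 8 * (k : ℝ) + 1) *
                ((harmonic (2 * k) : ℝ) - 5 / 4 * (harmonic k : ℝ))
              + 4 * (k : ℝ) + 1))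
          / ((3 * (k : ℝ) + 1) * (3 * (k : ℝ) + 2) * 16 ^ k))
      (Real.log 2) ∧
    HasSum (fun k : ℕ =>
        ((Nat.choose (4 * k) k : ℝ) *
            ((11 * (k : ℝ) ^ 2 + 8 * (k : ℝ) + 1) *
                (10 * (harmonic (4 * k) : ℝ) - 17 * (harmonic (2 * k) : ℝ))
              + 2 * (k : ℝ) + 18))
          / ((3 * (k : ℝ) + 1) * (3 * (k : ℝ) + 2) * 16 ^ k))
      (8 * Real.log 2) := by
  refine ⟨?_, ?_, ?_⟩
  · let e : ℕ ≃ Set.Ici (1 : ℕ) :=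
      { toFun := fun k => ⟨k + 1, Nat.le_add_left 1 k⟩
        invFun := fun k => k - 1
        left_inv := fun k => rfl
        right_inv := fun k => Subtype.ext (Nat.sub_add_cancel k.2) }
    rw [← e.hasSum_iff]
    -- In each case (u, v, w) solves the linear system matching the coefficients 2u, -5u + v + 2w,
    -- 2u - 2v - w of H_{4k}, H_{2k}, H_k in `ballotLog_diag`.
    refine hasSum_of_eq (hasSum_ballot_diagonal 0 (-2 / 3) (1 / 3)) (fun k => ?_) ?_
    · simp only [Function.comp_apply, e, Equiv.coe_fn_mk]
      rw [ballot_diag, ballotLog_diag]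
      unfold harm
      have : ((k + 1 : ℕ) : ℝ) ≠ 0 := by positivity
      field_simp
      ring
    · ring
  -- The k = 0 term, here 1/2 and in the third series 9, cancels the constant -u - v/2 - w.
  · rw [← hasSum_nat_add_iff' 1]
    refine hasSum_of_eq (hasSum_ballot_diagonal 0 (1 / 2) (1 / 4)) (fun k => ?_) ?_
    · rw [ballot_diag, ballotLog_diag]
      unfold harm
      have : ((k + 1 : ℕ) : ℝ) ≠ 0 := by positivity
      field_simp
      ring
    · simp
      ring
  · rw [← hasSum_nat_add_iff' 1]
    refine hasSum_of_eq (hasSum_ballot_diagonal 5 4 2) (fun k => ?_) ?_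
    · rw [ballot_diag, ballotLog_diag]
      unfold harm
      have : ((k + 1 : ℕ) : ℝ) ≠ 0 := by positivity
      field_simp
      ring
    · simp
      ring
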